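/- For $a\in I=[0,1]$ let $a=\sum_{i\ge 0} r_2^i(a)\,2^{-(i+1)}$, $r_2^i(a)\in\{0,1\}$, be its binary expansion, chosen with infinitely many non-zero digits when $a\neq 0$. Let $I_1$ be the metric space $(I,d_1)$ with $$d_1(a,b)=\sum_{i\ge 0}\frac{1}{2^i}\,\bigl|r_2^i(a)-r_2^i(b)\bigr| .$$ For a metric space $(X,d)$ let $\Sigma(X)=X^{\mathbb{Z}_{\ge 0}}$ with the metric $$\rho(x,y)=\sum_{i\ge 0}\frac{1}{2^i}\,\frac{d(x_i,y_i)}{1+d(x_i,y_i)}$$ and the shift map $\sigma$, $(\sigma(x))_i=x_{i+1}$; and let $\Sigma^2(X)=\Sigma(\Sigma(X))$, formed from the metric space $(\Sigma(X),\rho)$, with its own metric and shift map. **Theorem.** $(\Sigma(I_1),\sigma)$ is topologically conjugate to $(\Sigma^2(I_1),\sigma)$, i.e. there is a homeomorphism $h:\Sigma(I_1)\to\Sigma^2(I_1)$ with $h\circ\sigma=\sigma\circ h$. Moreover, $\Sigma(I_1)$ is homeomorphic to $I_1$. -/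

import Mathlib

/-- `s` is the chosen binary expansion of `a`: `a = ∑ sᵢ / 2^(i+1)` and, when `a ≠ 0`,
infinitely many digits are non-zero. -/
def IsBinaryExpansion (a : ℝ) (s : ℕ → Fin 2) : Prop :=
  HasSum (fun i : ℕ => ((s i : ℕ) : ℝ) / 2 ^ (i + 1)) a ∧ (a ≠ 0 → {i : ℕ | s i ≠ 0}.Infinite)

theorem exists_isBinaryExpansion {a : ℝ} (ha0 : 0 ≤ a) (ha1 : a ≤ 1) :
    ∃ s, IsBinaryExpansion a s := by
  rcases ha0.eq_or_lt with rfl | hpos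
  · exact ⟨fun _ => 0, by simp, fun h => absurd rfl h⟩
  · let c : ℕ → ℤ := fun n => ⌈2 ^ n * a⌉ - 1
    have hc1 : ∀ n, (c n : ℝ) < 2 ^ n * a := fun n => by
      have := Int.ceil_lt_add_one (2 ^ n * a); simp only [c]; push_cast; linarith
    have hc2 : ∀ n, 2 ^ n * a ≤ (c n : ℝ) + 1 := fun n => by
      have := Int.le_ceil (2 ^ n * a); simp only [c]; push_cast; linarith
    have hd : ∀ n, c (n + 1) = 2 * c n ∨ c (n + 1) = 2 * c n + 1 := fun n => by
      have h1 := hc1 n; have h2 := hc2 n; have h3 := hc1 (n + 1); have h4 := hc2 (n + 1)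
      rw [pow_succ] at h3 h4
      have h5 : (c (n + 1) : ℝ) < ((2 * c n + 2 : ℤ) : ℝ) := by push_cast; linarith
      have h6 : ((2 * c n : ℤ) : ℝ) < ((c (n + 1) + 1 : ℤ) : ℝ) := by push_cast; linarith
      have h7 := Int.cast_lt.mp h5
      have h8 := Int.cast_lt.mp h6
      omega
    have hc0 : c 0 = 0 := by
      have h1 := hc1 0; have h2 := hc2 0
      have h5 : ((c 0 : ℤ) : ℝ) < ((1 : ℤ) : ℝ) := by push_cast; linarith
      have h6 : ((-1 : ℤ) : ℝ) < ((c 0 : ℤ) : ℝ) := by push_cast; linarith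
      have h7 := Int.cast_lt.mp h5
      have h8 := Int.cast_lt.mp h6
      omega
    let s : ℕ → Fin 2 := fun n => if c (n + 1) = 2 * c n then 0 else 1
    have hs : ∀ n, (c (n + 1) : ℝ) = 2 * c n + ((s n : ℕ) : ℝ) := fun n => by
      rcases hd n with h | h
      · simp [s, h]
      · have : ¬ (c (n + 1) = 2 * c n) := by omega
        simp [s, h]
    have hsum : ∀ n, ∑ i ∈ Finset.range n, ((s i : ℕ) : ℝ) / 2 ^ (i + 1) = c n / 2 ^ n := by
      intro n
      induction n with
      | zero => simp [hc0]
      | succ k ih =>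
        rw [Finset.sum_range_succ, ih, hs, pow_succ]
        field_simp
    refine ⟨s, ?_, fun _ hfin => ?_⟩
    · rw [hasSum_iff_tendsto_nat_of_nonneg (fun i => by positivity)]
      simp only [hsum]
      have hlim : Filter.Tendsto (fun n : ℕ => a - (1 / 2 : ℝ) ^ n) Filter.atTop (nhds a) := by
        simpa using (tendsto_pow_atTop_nhds_zero_of_lt_one (r := (1 / 2 : ℝ))
          (by norm_num) (by norm_num)).const_sub a
      refine tendsto_of_tendsto_of_tendsto_of_le_of_le hlim tendsto_const_nhds ?_ ?_
      · intro n
        have h := hc2 n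
        have hp : (0 : ℝ) < 2 ^ n := by positivity
        simp only [one_div, inv_pow]
        rw [le_div_iff₀ hp, sub_mul, inv_mul_cancel₀ hp.ne']
        linarith
      · intro n
        have hp : (0 : ℝ) < 2 ^ n := by positivity
        simp only
        rw [div_le_iff₀ hp]
        linarith [hc1 n]
    · obtain ⟨N, hN⟩ := hfin.bddAbove
      have hz : ∀ n, N < n → s n = 0 := fun n hn => by
        by_contra h
        exact absurd (hN h) (by omega)
      have hgrow : ∀ k : ℕ, (2 : ℝ) ^ k * (2 ^ (N + 1) * a - c (N + 1)) ≤ 1 := by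
        intro k
        have : (c (N + 1 + k) : ℝ) = 2 ^ k * c (N + 1) := by
          induction k with
          | zero => simp
          | succ k ih =>
            rw [← add_assoc, hs, hz _ (by omega), ih, pow_succ]
            simp; ring
        have h := hc2 (N + 1 + k)
        rw [this, pow_add] at h
        linarith
      have hε : 0 < 2 ^ (N + 1) * a - c (N + 1) := by linarith [hc1 (N + 1)]
      obtain ⟨k, hk⟩ := pow_unbounded_of_one_lt (1 / (2 ^ (N + 1) * a - c (N + 1)))
        (one_lt_two (α := ℝ))
      rw [div_lt_iff₀ hε] at hk
      linarith [hgrow k]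

theorem IsBinaryExpansion.unique {a : ℝ} {s t : ℕ → Fin 2}
    (hs : IsBinaryExpansion a s) (ht : IsBinaryExpansion a t) : s = t := by
  by_cases ha : a = 0
  · subst ha
    have key : ∀ u : ℕ → Fin 2, IsBinaryExpansion 0 u → ∀ i, u i = 0 := fun u hu i => by
      have h := (hasSum_zero_iff_of_nonneg (fun i => by positivity)).mp hu.1
      have hi := congrFun h i
      have : ((u i : ℕ) : ℝ) = 0 := by simpa using hi
      exact Fin.ext (Nat.cast_eq_zero.mp this)
    funext i
    rw [key s hs i, key t ht i]
  · -- the first `n` digits, read as an integer, are determined by `a`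
    have key : ∀ u : ℕ → Fin 2, IsBinaryExpansion a u → ∃ p : ℕ → ℤ,
        (∀ n, (p n : ℝ) < 2 ^ n * a) ∧ (∀ n, 2 ^ n * a ≤ (p n : ℝ) + 1) ∧
        ∀ n, p (n + 1) = 2 * p n + ((u n : ℕ) : ℤ) := by
      intro u hu
      obtain ⟨p, hp0, hp⟩ : ∃ p : ℕ → ℤ, p 0 = 0 ∧
          ∀ n, p (n + 1) = 2 * p n + ((u n : ℕ) : ℤ) :=
        ⟨fun n => Nat.rec (motive := fun _ => ℤ) 0 (fun k q => 2 * q + ((u k : ℕ) : ℤ)) n,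
          rfl, fun _ => rfl⟩
      have hsum : ∀ n, ∑ i ∈ Finset.range n, ((u i : ℕ) : ℝ) / 2 ^ (i + 1) = (p n : ℝ) / 2 ^ n := by
        intro n
        induction n with
        | zero => simp [hp0]
        | succ k ih =>
          rw [Finset.sum_range_succ, ih, hp, pow_succ]
          push_cast
          field_simp
      refine ⟨p, fun n => ?_, fun n => ?_, hp⟩
      · obtain ⟨m, hm, hnm⟩ := (hu.2 ha).exists_gt n
        have hle : ∑ i ∈ insert m (Finset.range n), ((u i : ℕ) : ℝ) / 2 ^ (i + 1) ≤ a :=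
          sum_le_hasSum _ (fun i _ => by positivity) hu.1
        rw [Finset.sum_insert (by simp; omega), hsum] at hle
        have hm1 : (0 : ℝ) < ((u m : ℕ) : ℝ) / 2 ^ (m + 1) := by
          have : 0 < (u m : ℕ) := Nat.pos_of_ne_zero fun h => hm (Fin.ext h)
          positivity
        have : (p n : ℝ) / 2 ^ n < a := by linarith
        rw [div_lt_iff₀ (by positivity)] at this
        linarith
      · have hmono : ∀ m, n ≤ m → (p m : ℝ) + 1 ≤ 2 ^ (m - n) * (p n + 1) := by
          intro m hm
          induction m, hm using Nat.le_induction with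
          | base => simp
          | succ k hk ih =>
            have h1 : ((u k : ℕ) : ℝ) ≤ 1 := by exact_mod_cast Nat.lt_succ_iff.mp (u k).2
            rw [hp, Nat.succ_sub hk, pow_succ]
            push_cast
            linarith
        have htend := hu.1.tendsto_sum_nat
        have hle : a ≤ ((p n : ℝ) + 1) / 2 ^ n := by
          refine le_of_tendsto htend ?_
          filter_upwards [Filter.eventually_ge_atTop n] with m hm
          rw [hsum, div_le_div_iff₀ (by positivity) (by positivity)]
          have h := hmono m hm
          have h2 : (2 : ℝ) ^ m = 2 ^ (m - n) * 2 ^ n := by rw [← pow_add]; congr 1; omega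
          rw [h2]
          have hpn : (0 : ℝ) < 2 ^ n := by positivity
          nlinarith
        rw [le_div_iff₀ (by positivity)] at hle
        linarith
    obtain ⟨p, hp1, hp2, hp⟩ := key s hs
    obtain ⟨q, hq1, hq2, hq⟩ := key t ht
    have hpq : ∀ n, p n = q n := fun n => by
      have h1 : (p n : ℝ) < ((q n + 1 : ℤ) : ℝ) := by push_cast; linarith [hp1 n, hq2 n]
      have h2 : (q n : ℝ) < ((p n + 1 : ℤ) : ℝ) := by push_cast; linarith [hq1 n, hp2 n]
      have h3 := Int.cast_lt.mp h1
      have h4 := Int.cast_lt.mp h2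
      omega
    funext n
    have h1 := hp n
    have h2 := hq n
    rw [hpq (n + 1), hpq n] at h1
    exact Fin.ext (by omega)

theorem existsUnique_isBinaryExpansion (a : unitInterval) :
    ∃! s, IsBinaryExpansion (a : ℝ) s :=
  let ⟨s, hs⟩ := exists_isBinaryExpansion a.2.1 a.2.2
  ⟨s, hs, fun _ ht => ht.unique hs⟩

/-- The digits `r₂ⁱ(a)`, `i ≥ 0`, of the chosen binary expansion of `a ∈ [0, 1]`. -/
noncomputable def binaryDigit (a : unitInterval) : ℕ → Fin 2 :=
  (existsUnique_isBinaryExpansion a).choose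

theorem binaryDigit_spec (a : unitInterval) : IsBinaryExpansion (a : ℝ) (binaryDigit a) :=
  (existsUnique_isBinaryExpansion a).choose_spec.1

theorem binaryDigit_injective : Function.Injective binaryDigit := fun a b h =>
  Subtype.ext ((binaryDigit_spec a).1.unique (h ▸ (binaryDigit_spec b).1))

/-- `d₁(a, b) = ∑ 2⁻ⁱ |r₂ⁱ(a) - r₂ⁱ(b)|`. -/
noncomputable def binaryDist (a b : unitInterval) : ℝ :=
  ∑' i : ℕ, 1 / 2 ^ i * |((binaryDigit a i : ℕ) : ℝ) - ((binaryDigit b i : ℕ) : ℝ)|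

theorem summable_binaryDist (a b : unitInterval) : Summable fun i : ℕ =>
    1 / (2 : ℝ) ^ i * |((binaryDigit a i : ℕ) : ℝ) - ((binaryDigit b i : ℕ) : ℝ)| := by
  refine Summable.of_nonneg_of_le (fun i => by positivity) (fun i => ?_)
    summable_geometric_two
  have h1 : ((binaryDigit a i : ℕ) : ℝ) ≤ 1 := by
    exact_mod_cast Nat.lt_succ_iff.mp (binaryDigit a i).2
  have h2 : ((binaryDigit b i : ℕ) : ℝ) ≤ 1 := by
    exact_mod_cast Nat.lt_succ_iff.mp (binaryDigit b i).2
  have h3 : |((binaryDigit a i : ℕ) : ℝ) - ((binaryDigit b i : ℕ) : ℝ)| ≤ 1 :=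
    abs_le.mpr ⟨by linarith [Nat.cast_nonneg (α := ℝ) (binaryDigit a i : ℕ)],
      by linarith [Nat.cast_nonneg (α := ℝ) (binaryDigit b i : ℕ)]⟩
  rw [one_div_pow]
  exact mul_le_of_le_one_right (by positivity) h3

/-- The interval `[0, 1]`, to be given the metric `d₁` instead of the Euclidean one. -/
def BinaryInterval : Type := unitInterval

/-- The metric space `I₁ = ([0, 1], d₁)`. -/
noncomputable instance : MetricSpace BinaryInterval where
  dist := binaryDist
  dist_self a := by simp [binaryDist]
  dist_comm a b := by simp only [binaryDist, abs_sub_comm]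
  dist_triangle a b c := by
    unfold binaryDist
    rw [← (summable_binaryDist a b).tsum_add (summable_binaryDist b c)]
    refine (summable_binaryDist a c).tsum_le_tsum (fun i => ?_)
      ((summable_binaryDist a b).add (summable_binaryDist b c))
    rw [← mul_add]
    exact mul_le_mul_of_nonneg_left (abs_sub_le _ _ _) (by positivity)
  eq_of_dist_eq_zero {a b} h := by
    have hs : HasSum _ (binaryDist a b) := (summable_binaryDist a b).hasSum
    rw [h] at hs
    have h0 := (hasSum_zero_iff_of_nonneg (fun i => by positivity)).mp hs
    refine binaryDigit_injective (funext fun i => Fin.ext ?_)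
    have hi := congrFun h0 i
    have h1 : ((binaryDigit a i : ℕ) : ℝ) - ((binaryDigit b i : ℕ) : ℝ) = 0 := by
      simpa using hi
    exact_mod_cast sub_eq_zero.mp h1

/-- The symbol sequence space `Σ(X)` of one-sided sequences in `X`. -/
def SymbolSpace (X : Type*) : Type _ := ℕ → X

namespace SymbolSpace

variable {X : Type*}

/-- The shift map `σ`. -/
def shift (x : SymbolSpace X) : SymbolSpace X := fun i => x (i + 1)

variable [MetricSpace X]

/-- `ρ(x, y) = ∑ 2⁻ⁱ d(xᵢ, yᵢ) / (1 + d(xᵢ, yᵢ))`. -/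
noncomputable def rho (x y : SymbolSpace X) : ℝ :=
  ∑' i : ℕ, 1 / 2 ^ i * (dist (x i) (y i) / (1 + dist (x i) (y i)))

theorem summable_rho (x y : SymbolSpace X) : Summable fun i : ℕ =>
    1 / (2 : ℝ) ^ i * (dist (x i) (y i) / (1 + dist (x i) (y i))) := by
  refine Summable.of_nonneg_of_le (fun i => by positivity) (fun i => ?_)
    summable_geometric_two
  rw [one_div_pow]
  refine mul_le_of_le_one_right (by positivity) ?_
  rw [div_le_one (by positivity)]
  linarith

/-- `Σ(X)` with the metric `ρ`; its topology is the one of `ρ`. -/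
noncomputable instance : MetricSpace (SymbolSpace X) where
  dist := rho
  dist_self x := by simp [rho]
  dist_comm x y := by simp only [rho, dist_comm]
  dist_triangle x y z := by
    unfold rho
    rw [← (summable_rho x y).tsum_add (summable_rho y z)]
    refine (summable_rho x z).tsum_le_tsum (fun i => ?_)
      ((summable_rho x y).add (summable_rho y z))
    rw [← mul_add]
    refine mul_le_mul_of_nonneg_left ?_ (by positivity)
    have ht := dist_triangle (x i) (y i) (z i)
    have h1 := dist_nonneg (x := x i) (y := y i)
    have h2 := dist_nonneg (x := y i) (y := z i)
    have h3 := dist_nonneg (x := x i) (y := z i)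
    generalize dist (x i) (y i) = u at *
    generalize dist (y i) (z i) = v at *
    generalize dist (x i) (z i) = w at *
    calc w / (1 + w) ≤ (u + v) / (1 + (u + v)) := by
          rw [div_le_div_iff₀ (by positivity) (by positivity)]; nlinarith
      _ = u / (1 + (u + v)) + v / (1 + (u + v)) := add_div _ _ _
      _ ≤ u / (1 + u) + v / (1 + v) := by gcongr <;> linarith
  eq_of_dist_eq_zero {x y} h := by
    have hs : HasSum _ (rho x y) := (summable_rho x y).hasSum
    rw [h] at hs
    have h0 := (hasSum_zero_iff_of_nonneg (fun i => by positivity)).mp hs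
    refine funext fun i => ?_
    have hi := congrFun h0 i
    have h1 : 1 + dist (x i) (y i) ≠ 0 := by positivity
    have h2 : dist (x i) (y i) = 0 := by
      simpa [-dist_eq_zero, h1] using hi
    exact dist_eq_zero.mp h2

end SymbolSpace

/-- `f ∼ g`: there is a homeomorphism `h` with `h ∘ f = g ∘ h`. -/
def TopologicallyConjugate {X Y : Type*} [TopologicalSpace X] [TopologicalSpace Y]
    (f : X → X) (g : Y → Y) : Prop :=
  ∃ h : X ≃ₜ Y, h ∘ f = g ∘ h

/-! ### The topologies of the metrics `d₁` and `ρ` -/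

section Topology

open Filter Topology

/-! A homeomorphism `X ≃ₜ Y` applied in every coordinate commutes with the shifts, so both claims
reduce to `I₁ ≃ₜ Σ(I₁)`. Since `ρ` induces the product topology, it is enough that `I₁` is the Baire
space `ℕ → ℕ`, which equals its own countable power by pairing indices.

The digits embed `I₁` into Cantor space, with image the zero sequence together with all sequences
having infinitely many ones (`range_digits`). `BaireCode.code` embeds the Baire space onto the same
set: zero goes to zero; if `n` is the first index with `x n ≠ 0`, the ones are at `n` and at `pos x
i` for `i ≥ n`. The first one records the number of leading zeros, so codes tend to zero as `n`
grows, and later gaps record `x n, x (n + 1), …`. -/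

theorem isInducing_of_dist_continuous {X Y : Type*} [MetricSpace X] [TopologicalSpace Y]
    {f : X → Y} (hf : Continuous f)
    (hd : ∀ x, ∀ l : Filter X, Tendsto f l (𝓝 (f x)) → Tendsto (fun y => dist y x) l (𝓝 0)) :
    IsInducing f := by
  rw [isInducing_iff_nhds]
  intro x
  refine le_antisymm hf.continuousAt.le_comap ?_
  have := hd x (comap f (𝓝 (f x))) tendsto_comap
  exact tendsto_iff_dist_tendsto_zero.mpr this

/-- A disagreement at digit `i` alone contributes `1 / 2 ^ i` to `d₁`. -/
theorem binaryDigit_eq_of_dist_lt {a b : BinaryInterval} {i : ℕ} (h : dist a b < 1 / 2 ^ i) :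
    binaryDigit a i = binaryDigit b i := by
  by_contra hne
  have h1 := (summable_binaryDist a b).le_tsum i (fun j _ => by positivity)
  have h2 : (1 : ℝ) ≤ |((binaryDigit a i : ℕ) : ℝ) - ((binaryDigit b i : ℕ) : ℝ)| := by
    have : ((binaryDigit a i : ℕ) : ℤ) - ((binaryDigit b i : ℕ) : ℤ) ≠ 0 := fun h0 =>
      hne (Fin.ext (by omega))
    exact_mod_cast Int.one_le_abs this
  have h3 : (1 : ℝ) / 2 ^ i ≤
      1 / 2 ^ i * |((binaryDigit a i : ℕ) : ℝ) - ((binaryDigit b i : ℕ) : ℝ)| :=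
    le_mul_of_one_le_right (by positivity) h2
  exact absurd h (not_lt.mpr (h3.trans h1))

/-- The digits as a function on the metric space `I₁`. -/
noncomputable def BinaryInterval.digits (a : BinaryInterval) : ℕ → Fin 2 := binaryDigit a

theorem BinaryInterval.isEmbedding_digits : IsEmbedding BinaryInterval.digits := by
  refine ⟨isInducing_of_dist_continuous ?_ ?_, binaryDigit_injective⟩
  · refine continuous_pi fun i => continuous_iff_continuousAt.mpr fun a => ?_
    refine tendsto_nhds_of_eventually_eq ?_
    filter_upwards [Metric.ball_mem_nhds a (show (0 : ℝ) < 1 / 2 ^ i by positivity)] with b hb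
    exact binaryDigit_eq_of_dist_lt hb
  · intro a l hl
    -- The distance to `a` extends to all of Cantor space, continuously by the Weierstrass test, so
    -- convergence of digits forces `d₁`-convergence.
    let g : (ℕ → Fin 2) → ℝ := fun s =>
      ∑' i : ℕ, 1 / 2 ^ i * |((s i : ℕ) : ℝ) - ((binaryDigit a i : ℕ) : ℝ)|
    have hg : Continuous g := by
      refine continuous_tsum (u := fun i : ℕ => (1 / 2 : ℝ) ^ i) (fun i => ?_)
        summable_geometric_two fun i s => ?_
      · exact (continuous_of_discreteTopology (f := fun d : Fin 2 =>
          1 / (2 : ℝ) ^ i * |((d : ℕ) : ℝ) - ((binaryDigit a i : ℕ) : ℝ)|)).comp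
          (continuous_apply i)
      · have h1 : ((s i : ℕ) : ℝ) ≤ 1 := by exact_mod_cast Nat.lt_succ_iff.mp (s i).2
        have h2 : ((binaryDigit a i : ℕ) : ℝ) ≤ 1 := by
          exact_mod_cast Nat.lt_succ_iff.mp (binaryDigit a i).2
        have h3 : |((s i : ℕ) : ℝ) - ((binaryDigit a i : ℕ) : ℝ)| ≤ 1 :=
          abs_le.mpr ⟨by linarith [Nat.cast_nonneg (α := ℝ) (s i : ℕ)],
            by linarith [Nat.cast_nonneg (α := ℝ) (binaryDigit a i : ℕ)]⟩
        rw [Real.norm_of_nonneg (by positivity), one_div_pow]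
        exact mul_le_of_le_one_right (by positivity) h3
    have h0 : g (binaryDigit a) = 0 := by simp [g]
    have := (hg.tendsto (binaryDigit a)).comp hl
    rwa [h0] at this

namespace SymbolSpace

variable {X Y : Type*} [MetricSpace X] [MetricSpace Y]

/-- The coordinates of a point of `Σ(X)`. -/
def coord (x : SymbolSpace X) : ℕ → X := x

theorem isInducing_coord : IsInducing (coord : SymbolSpace X → ℕ → X) := by
  refine isInducing_of_dist_continuous ?_ ?_
  · refine continuous_pi fun i => Metric.continuous_iff.mpr fun x ε hε => ?_
    -- As `t / (1 + t)` is increasing, this bound on the `i`-th term gives distance below `ε` in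
    -- coordinate `i`.
    refine ⟨1 / 2 ^ i * (ε / (1 + ε)), by positivity, fun y hy => ?_⟩
    have h1 := (summable_rho y x).le_tsum i (fun j _ => by positivity)
    have h2 := lt_of_mul_lt_mul_left (h1.trans_lt hy) (by positivity)
    have h3 := dist_nonneg (x := y i) (y := x i)
    rw [div_lt_div_iff₀ (by positivity) (by positivity)] at h2
    change dist (y i) (x i) < ε
    linarith
  · intro x l hl
    let g : (ℕ → X) → ℝ := fun y =>
      ∑' i : ℕ, 1 / 2 ^ i * (dist (y i) (x i) / (1 + dist (y i) (x i)))
    have hg : Continuous g := by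
      refine continuous_tsum (u := fun i : ℕ => (1 / 2 : ℝ) ^ i) (fun i => ?_)
        summable_geometric_two fun i y => ?_
      · have hc : Continuous fun y : ℕ → X => dist (y i) (x i) :=
          (continuous_apply i).dist continuous_const
        exact continuous_const.mul (hc.div (continuous_const.add hc) fun y => by positivity)
      · rw [Real.norm_of_nonneg (by positivity), one_div_pow]
        refine mul_le_of_le_one_right (by positivity) ?_
        rw [div_le_one (by positivity)]
        linarith
    have h0 : g x = 0 := by simp [g]
    have := (hg.tendsto x).comp hl
    rwa [h0] at this

/-- `Σ(X)` carries the product topology. -/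
noncomputable def homeomorphPi (X : Type*) [MetricSpace X] : SymbolSpace X ≃ₜ (ℕ → X) :=
  Equiv.toHomeomorphOfIsInducing ⟨coord, fun x => x, fun _ => rfl, fun _ => rfl⟩ isInducing_coord

/-- A homeomorphism `X ≃ₜ Y`, applied in each coordinate. -/
noncomputable def congr (e : X ≃ₜ Y) : SymbolSpace X ≃ₜ SymbolSpace Y :=
  (homeomorphPi X).trans ((Homeomorph.piCongrRight fun _ => e).trans (homeomorphPi Y).symm)

theorem topologicallyConjugate_shift (e : X ≃ₜ Y) :
    TopologicallyConjugate (shift : SymbolSpace X → SymbolSpace X)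
      (shift : SymbolSpace Y → SymbolSpace Y) :=
  ⟨congr e, rfl⟩

end SymbolSpace

end Topology

/-! ### The digit sequences of `[0, 1]` -/

/-- By uniqueness, an admissible sequence is the chosen expansion of its own sum. -/
theorem range_digits : Set.range BinaryInterval.digits =
    {s | s = 0 ∨ {i : ℕ | s i ≠ 0}.Infinite} := by
  ext s
  constructor
  · rintro ⟨a, rfl⟩
    have ha := binaryDigit_spec a
    by_cases h : Subtype.val (p := (· ∈ unitInterval)) a = 0
    · left
      refine IsBinaryExpansion.unique ha ?_
      rw [h]
      exact ⟨by simp, fun h => absurd rfl h⟩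
    · exact Or.inr (ha.2 h)
  · intro hs
    have hle : ∀ i, ((s i : ℕ) : ℝ) / 2 ^ (i + 1) ≤ 1 / 2 / 2 ^ i := fun i => by
      have h1 : ((s i : ℕ) : ℝ) ≤ 1 := by exact_mod_cast Nat.lt_succ_iff.mp (s i).2
      rw [div_div, ← pow_succ']
      gcongr
    have hsum : Summable fun i : ℕ => ((s i : ℕ) : ℝ) / 2 ^ (i + 1) :=
      Summable.of_nonneg_of_le (fun i => by positivity) hle (summable_geometric_two' 1)
    have h0 : 0 ≤ ∑' i : ℕ, ((s i : ℕ) : ℝ) / 2 ^ (i + 1) := tsum_nonneg fun i => by positivity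
    have h1 : ∑' i : ℕ, ((s i : ℕ) : ℝ) / 2 ^ (i + 1) ≤ 1 :=
      (hsum.tsum_le_tsum hle (summable_geometric_two' 1)).trans_eq (tsum_geometric_two' 1)
    refine ⟨(⟨_, h0, h1⟩ : unitInterval), ?_⟩
    refine (binaryDigit_spec _).unique ⟨hsum.hasSum, fun hne => hs.resolve_left ?_⟩
    rintro rfl
    simp at hne

/-! ### Coding `ℕ → ℕ` by binary sequences that vanish or have infinitely many ones -/

namespace BaireCode

/-- The position attached to index `i`. -/
def pos (x : ℕ → ℕ) (i : ℕ) : ℕ := i + ∑ j ∈ Finset.range (i + 1), x j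

/-- `m` is the first index where `x` does not vanish, or the position of this or a later index. -/
def IsOne (x : ℕ → ℕ) (m : ℕ) : Prop :=
  (x m ≠ 0 ∧ ∀ j < m, x j = 0) ∨ ∃ i, (∃ j ≤ i, x j ≠ 0) ∧ m = pos x i

open Classical in
/-- The binary sequence coding `x`. -/
noncomputable def code (x : ℕ → ℕ) (m : ℕ) : Fin 2 := if IsOne x m then 1 else 0

theorem code_ne_zero {x : ℕ → ℕ} {m : ℕ} : code x m ≠ 0 ↔ IsOne x m := by
  by_cases h : IsOne x m <;> simp [code, h]

theorem code_eq_code {x y : ℕ → ℕ} {m : ℕ} : code x m = code y m ↔ (IsOne x m ↔ IsOne y m) := by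
  by_cases h : IsOne x m <;> by_cases h' : IsOne y m <;> simp [code, h, h']

theorem pos_succ (x : ℕ → ℕ) (i : ℕ) : pos x (i + 1) = pos x i + 1 + x (i + 1) := by
  rw [pos, pos, Finset.sum_range_succ _ (i + 1)]
  omega

theorem pos_strictMono (x : ℕ → ℕ) : StrictMono (pos x) :=
  strictMono_nat_of_lt_succ fun i => by rw [pos_succ]; omega

theorem le_pos (x : ℕ → ℕ) (i : ℕ) : i ≤ pos x i := Nat.le_add_right _ _

theorem pos_eq_self {x : ℕ → ℕ} {i : ℕ} : pos x i = i ↔ ∀ j ≤ i, x j = 0 := by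
  simp [pos]

theorem pos_congr {x y : ℕ → ℕ} {i : ℕ} (h : ∀ j ≤ i, x j = y j) : pos x i = pos y i := by
  rw [pos, pos, Finset.sum_congr rfl fun j hj => h j (Nat.lt_succ_iff.mp (Finset.mem_range.mp hj))]

/-- Since `i ≤ pos x i`, digit `m` of the code sees only the entries up to `m`; this makes `code`
continuous. -/
theorem IsOne.congr {x y : ℕ → ℕ} {m : ℕ} (h : ∀ j ≤ m, x j = y j) (hx : IsOne x m) :
    IsOne y m := by
  rcases hx with ⟨h1, h2⟩ | ⟨i, ⟨j, hj, hj0⟩, hm⟩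
  · exact Or.inl ⟨h m le_rfl ▸ h1, fun j hj => h j hj.le ▸ h2 j hj⟩
  · have hi : i ≤ m := hm ▸ le_pos x i
    exact Or.inr ⟨i, ⟨j, hj, h j (hj.trans hi) ▸ hj0⟩,
      hm.trans (pos_congr fun k hk => h k (hk.trans hi))⟩

theorem exists_isOne_iff {x : ℕ → ℕ} {m : ℕ} :
    (∃ j ≤ m, IsOne x j) ↔ ∃ j ≤ m, x j ≠ 0 := by
  constructor
  · rintro ⟨j, hj, ⟨h, -⟩ | ⟨i, ⟨k, hk, hk0⟩, rfl⟩⟩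
    · exact ⟨j, hj, h⟩
    · exact ⟨k, hk.trans ((le_pos x i).trans hj), hk0⟩
  · rintro ⟨j, hj, hj0⟩
    classical
    have hex : ∃ j, x j ≠ 0 := ⟨j, hj0⟩
    exact ⟨Nat.find hex, (Nat.find_min' hex hj0).trans hj,
      Or.inl ⟨Nat.find_spec hex, fun k hk => not_not.mp (Nat.find_min hex hk)⟩⟩

/-- The one at `pos x i` cannot be the leading one of `y`, which would force `pos x i = i`, nor `pos
y k` with `k < i`, which equals `pos x k`. Hence it is `pos y k` with `k ≥ i`. -/
theorem pos_le_of_isOne {x y : ℕ → ℕ} {i : ℕ} (h : ∀ j < i, x j = y j)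
    (hx : ∃ j ≤ i, x j ≠ 0) (hy : ∃ j ≤ i, y j ≠ 0) (h1 : IsOne y (pos x i)) :
    pos y i ≤ pos x i := by
  rcases h1 with ⟨-, h2⟩ | ⟨k, -, hk⟩
  · obtain ⟨j, hj, hj0⟩ := hy
    have hle : pos x i ≤ j := not_lt.mp fun hlt => hj0 (h2 j hlt)
    obtain ⟨k, hk, hk0⟩ := hx
    exact absurd (pos_eq_self.mp ((hle.trans hj).antisymm (le_pos x i)) k hk) hk0
  · rw [hk]
    refine (pos_strictMono y).monotone (not_lt.mp fun hki => ?_)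
    rw [← pos_congr fun j hj => h j (hj.trans_lt hki)] at hk
    exact (pos_strictMono x hki).ne' hk

/-- The digits of the code of `x` up to `pos x i` determine `x i`. -/
theorem eq_of_isOne_iff {x y : ℕ → ℕ} {m : ℕ} (h : ∀ k < m, IsOne x k ↔ IsOne y k) (i : ℕ)
    (hi : pos x i < m) : x i = y i := by
  induction i using Nat.strong_induction_on with
  | _ i ih =>
    have hlt : ∀ j < i, x j = y j := fun j hj => ih j hj ((pos_strictMono x hj).trans hi)
    have him : i < m := (le_pos x i).trans_lt hi
    have hiff : (∃ j ≤ i, x j ≠ 0) ↔ ∃ j ≤ i, y j ≠ 0 := by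
      rw [← exists_isOne_iff, ← exists_isOne_iff]
      exact exists_congr fun j => and_congr_right fun hj => h j (hj.trans_lt him)
    by_cases hx : ∃ j ≤ i, x j ≠ 0
    · have hy := hiff.mp hx
      have h1 := pos_le_of_isOne hlt hx hy ((h _ hi).mp (Or.inr ⟨i, hx, rfl⟩))
      -- The bound `h1` puts `pos y i` below `m`, where the codes are known to agree.
      have h2 := pos_le_of_isOne (fun j hj => (hlt j hj).symm) hy hx
        ((h _ (h1.trans_lt hi)).mpr (Or.inr ⟨i, hy, rfl⟩))
      have h3 : pos x i = pos y i := h2.antisymm h1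
      have h4 : ∑ j ∈ Finset.range i, x j = ∑ j ∈ Finset.range i, y j :=
        Finset.sum_congr rfl fun j hj => hlt j (Finset.mem_range.mp hj)
      rw [pos, pos, Finset.sum_range_succ, Finset.sum_range_succ, h4] at h3
      omega
    · have hy : ¬ ∃ j ≤ i, y j ≠ 0 := fun hy => hx (hiff.mpr hy)
      push Not at hx hy
      rw [hx i le_rfl, hy i le_rfl]

open Topology Filter in
-- Digit `m` depends on finitely many entries, and entry `i` is recovered from the digits up to `pos
-- x i`, a bound fixed near the code of `x`.
theorem isEmbedding_code : IsEmbedding code := by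
  refine ⟨isInducing_iff_nhds.mpr fun x => le_antisymm ?_ ?_, fun x y h => funext fun i => ?_⟩
  · refine Continuous.continuousAt (continuous_pi fun m => ?_) |>.le_comap
    refine continuous_iff_continuousAt.mpr fun x => tendsto_nhds_of_eventually_eq ?_
    have : ∀ᶠ y in 𝓝 x, ∀ j ∈ Set.Iic m, y j = x j :=
      (eventually_all_finite (Set.finite_Iic m)).mpr fun j _ =>
        (continuous_apply j).continuousAt (mem_nhds_discrete.mpr (Set.mem_singleton _))
    filter_upwards [this] with y hy
    exact code_eq_code.mpr
      ⟨IsOne.congr fun j hj => hy j hj, IsOne.congr fun j hj => (hy j hj).symm⟩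
  · have htend : Tendsto code (comap code (𝓝 (code x))) (𝓝 (code x)) := tendsto_comap
    refine tendsto_id'.mp <| tendsto_pi_nhds.mpr fun i => tendsto_nhds_of_eventually_eq ?_
    have : ∀ᶠ y in comap code (𝓝 (code x)), ∀ k ∈ Set.Iio (pos x i + 1), code y k = code x k :=
      (eventually_all_finite (Set.finite_Iio _)).mpr fun k _ =>
        tendsto_pi_nhds.mp htend k (mem_nhds_discrete.mpr (Set.mem_singleton _))
    filter_upwards [this] with y hy
    exact (eq_of_isOne_iff (fun k hk => (code_eq_code.mp (hy k hk)).symm) i (Nat.lt_succ_self _)).symm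
  · exact eq_of_isOne_iff (m := pos x i + 1) (fun k _ => code_eq_code.mp (congrFun h k)) i
      (Nat.lt_succ_self _)

theorem exists_pos_eq {R : ℕ → ℕ} (hR : StrictMono R) : ∃ x, ∀ i, pos x i = R i := by
  refine ⟨fun i => Nat.casesOn i (R 0) fun k => R (k + 1) - R k - 1, fun i => ?_⟩
  induction i with
  | zero => simp [pos]
  | succ i ih =>
    have := hR i.lt_add_one
    rw [pos_succ, ih]
    simp only
    omega

theorem range_code : Set.range code = {s | s = 0 ∨ {i : ℕ | s i ≠ 0}.Infinite} := by
  ext s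
  constructor
  · rintro ⟨x, rfl⟩
    by_cases hx : ∃ n, x n ≠ 0
    · obtain ⟨n, hn⟩ := hx
      refine Or.inr (Set.infinite_of_injective_forall_mem (f := fun i => pos x (n + i))
        (fun i j h => by simpa using (pos_strictMono x).injective h) fun i => ?_)
      exact code_ne_zero.mpr (Or.inr ⟨n + i, ⟨n, Nat.le_add_right _ _, hn⟩, rfl⟩)
    · left
      push Not at hx
      funext m
      by_contra h
      rcases code_ne_zero.mp h with ⟨h1, -⟩ | ⟨i, ⟨j, -, hj⟩, -⟩
      exacts [h1 (hx m), hj (hx j)]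
  · rintro (rfl | hs)
    · refine ⟨0, funext fun m => ?_⟩
      by_contra h
      rcases code_ne_zero.mp h with ⟨h1, -⟩ | ⟨i, ⟨j, -, hj⟩, -⟩
      exacts [h1 rfl, hj rfl]
    · obtain ⟨p, hp, hrange⟩ : ∃ p : ℕ → ℕ, StrictMono p ∧ ∀ m, s m ≠ 0 ↔ ∃ k, p k = m :=
        ⟨Nat.nth fun i => s i ≠ 0, Nat.nth_strictMono hs, fun m =>
          (Set.ext_iff.mp (Nat.range_nth_of_infinite hs) m).symm⟩
      -- With `p` enumerating the ones of `s`, the identity below `p 0` encodes the leading zeros of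
      -- `x`. From index `p 0` on, the positions are `p 1, p 2, …`; `p 0` itself is the leading one.
      have hR : StrictMono fun i => if i < p 0 then i else p (i - p 0 + 1) := by
        refine strictMono_nat_of_lt_succ fun i => ?_
        rcases lt_trichotomy (i + 1) (p 0) with h | h | h
        · simp [h, Nat.lt_of_succ_lt h]
        · have := hp Nat.zero_lt_one
          simp [← h]
          omega
        · rw [if_neg (by omega), if_neg (by omega)]
          exact hp (by omega)
      obtain ⟨x, hx⟩ := exists_pos_eq hR
      have hlt : ∀ j < p 0, x j = 0 := fun j hj =>
        pos_eq_self.mp ((hx j).trans (if_pos hj)) j le_rfl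
      have hge : ∀ k, pos x (p 0 + k) = p (k + 1) := fun k => by
        rw [hx, if_neg (by omega), Nat.add_sub_cancel_left]
      -- Otherwise `pos x (p 0)` would be `p 0` instead of `p 1`.
      have hne : x (p 0) ≠ 0 := fun h0 => by
        have h1 : pos x (p 0) = p 0 := pos_eq_self.mpr fun j hj =>
          hj.lt_or_eq.elim (hlt j) fun h => h ▸ h0
        exact (hp Nat.zero_lt_one).ne' ((hge 0).symm.trans h1)
      have hone : ∀ m, IsOne x m ↔ s m ≠ 0 := fun m => by
        rw [hrange]
        constructor
        · rintro (⟨h1, h2⟩ | ⟨i, ⟨j, hj, hj0⟩, rfl⟩)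
          · exact ⟨0, le_antisymm (not_lt.mp fun h => h1 (hlt m h))
              (not_lt.mp fun h => hne (h2 _ h))⟩
          · have : p 0 ≤ i := (not_lt.mp fun h => hj0 (hlt j h)).trans hj
            obtain ⟨k, rfl⟩ := Nat.exists_eq_add_of_le this
            exact ⟨k + 1, (hge k).symm⟩
        · rintro ⟨k, rfl⟩
          cases k with
          | zero => exact Or.inl ⟨hne, hlt⟩
          | succ k => exact Or.inr ⟨p 0 + k, ⟨p 0, Nat.le_add_right _ _, hne⟩, (hge k).symm⟩
      refine ⟨x, funext fun m => ?_⟩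
      have h := code_ne_zero.trans (hone m)
      generalize code x m = c at h
      generalize s m = d at h
      fin_cases c <;> fin_cases d <;> simp_all

end BaireCode

/-! ### Homeomorphisms through the Baire space, and the conjugacy -/

/-- `I₁` is homeomorphic to the Baire space. -/
noncomputable def BinaryInterval.homeomorphBaire : BinaryInterval ≃ₜ (ℕ → ℕ) :=
  BinaryInterval.isEmbedding_digits.toHomeomorph.trans
    ((Homeomorph.setCongr (range_digits.trans BaireCode.range_code.symm)).trans
      BaireCode.isEmbedding_code.toHomeomorph.symm)

/-- The Baire space is homeomorphic to its countable power. -/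
def baireHomeomorphPi : (ℕ → ℕ) ≃ₜ (ℕ → ℕ → ℕ) :=
  (Homeomorph.piCongrLeft (Y := fun _ => ℕ) Nat.pairEquiv.symm).trans Homeomorph.piCurry

/-- `Σ(I₁)` is homeomorphic to `I₁`. -/
noncomputable def BinaryInterval.symbolSpaceHomeomorph :
    SymbolSpace BinaryInterval ≃ₜ BinaryInterval :=
  (SymbolSpace.homeomorphPi _).trans
    ((Homeomorph.piCongrRight fun _ => BinaryInterval.homeomorphBaire).trans
      (baireHomeomorphPi.symm.trans BinaryInterval.homeomorphBaire.symm))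

theorem theorem4p4 :
    TopologicallyConjugate
      (SymbolSpace.shift : SymbolSpace BinaryInterval → SymbolSpace BinaryInterval)
      (SymbolSpace.shift :
        SymbolSpace (SymbolSpace BinaryInterval) → SymbolSpace (SymbolSpace BinaryInterval)) ∧
    Nonempty (SymbolSpace BinaryInterval ≃ₜ BinaryInterval) :=
  ⟨SymbolSpace.topologicallyConjugate_shift BinaryInterval.symbolSpaceHomeomorph.symm,
    ⟨BinaryInterval.symbolSpaceHomeomorph⟩⟩
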